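/- Let $h,k\ge 1$ be integers and let $q$ be a prime power with $q\ge hk+1$. For a finite field $\mathbb F$, a normal rational curve of $\mathrm{PG}(hk-1,\mathbb F)$ is a set of points of the form $$\{\langle (g_0(u,t),\ldots,g_{hk-1}(u,t))\rangle_{\mathbb F} : (u,t)\in\mathbb F^2\setminus\{(0,0)\}\},$$ where $g_0,\ldots,g_{hk-1}$ is a basis of the $\mathbb F$-vector space of homogeneous polynomials of degree $hk-1$ in $\mathbb F[x,y]$. In $\mathrm{PG}(hk-1,q^h)$ let $$\Sigma=\{\langle (x_1,\ldots,x_{hk})\rangle_{\mathbb F_{q^h}} : (x_1,\ldots,x_{hk})\in\mathbb F_q^{hk}\setminus\{0\}\}$$ be the canonical subgeometry, identified with $\mathrm{PG}(hk-1,q)$ via $\langle x\rangle_{\mathbb F_q}\mapsto\langle x\rangle_{\mathbb F_{q^h}}$, and let $\Psi$ be the collineation $\langle (x_1,\ldots,x_{hk})\rangle_{\mathbb F_{q^h}}\mapsto\langle (x_1^q,\ldots,x_{hk}^q)\rangle_{\mathbb F_{q^h}}$. Let $\mathcal N$ be a normal rational curve of $\mathrm{PG}(hk-1,q^h)$. Then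 $\mathcal N\cap\Sigma$ is a normal rational curve of $\Sigma\cong\mathrm{PG}(hk-1,q)$ if and only if $\mathcal N^{\Psi}=\mathcal N$. -/

import Mathlib

open scoped LinearAlgebra.Projectivization

namespace NRC

/-- If `g` is a basis of the space of binary forms of degree `n - 1`, then the forms `g i` have no
common zero except the origin. -/
theorem eval_basis_ne_zero {K : Type*} [Field K] {n : ℕ}
    (g : Module.Basis (Fin n) K (MvPolynomial.homogeneousSubmodule (Fin 2) K (n - 1)))
    (v : Fin 2 → K) (hv : v ≠ 0) :
    (fun i => MvPolynomial.eval v (g i : MvPolynomial (Fin 2) K)) ≠ 0 := by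
  intro h0
  have hall : ∀ p : MvPolynomial.homogeneousSubmodule (Fin 2) K (n - 1),
      MvPolynomial.eval v (p : MvPolynomial (Fin 2) K) = 0 := by
    intro p
    have hp := congrArg (fun x : MvPolynomial.homogeneousSubmodule (Fin 2) K (n - 1) =>
      MvPolynomial.eval v (x : MvPolynomial (Fin 2) K)) (g.sum_repr p)
    simp only [Submodule.coe_sum, Submodule.coe_smul, map_sum, MvPolynomial.smul_eval] at hp
    rw [← hp]
    exact Finset.sum_eq_zero fun i _ => by rw [show _ = (0 : K) from congrFun h0 i, mul_zero]
  obtain ⟨j, hj⟩ := Function.ne_iff.mp hv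
  have hX : MvPolynomial.X j ^ (n - 1) ∈ MvPolynomial.homogeneousSubmodule (Fin 2) K (n - 1) := by
    rw [MvPolynomial.mem_homogeneousSubmodule]
    exact MvPolynomial.isHomogeneous_X_pow j (n - 1)
  have := hall ⟨_, hX⟩
  simp only [map_pow, MvPolynomial.eval_X] at this
  exact pow_ne_zero (n - 1) hj this

/-- The set of points `⟨(g₀(u,t), …, gₙ₋₁(u,t))⟩` of `PG(n-1, K)`, `(u,t) ≠ (0,0)`, for a basis `g`
of the space of binary forms of degree `n - 1`. -/
def curve {K : Type*} [Field K] {n : ℕ}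
    (g : Module.Basis (Fin n) K (MvPolynomial.homogeneousSubmodule (Fin 2) K (n - 1))) :
    Set (ℙ K (Fin n → K)) :=
  {P | ∃ (v : Fin 2 → K) (hv : v ≠ 0),
    P = Projectivization.mk K (fun i => MvPolynomial.eval v (g i : MvPolynomial (Fin 2) K))
      (eval_basis_ne_zero g v hv)}

/-- `N` is a normal rational curve of `PG(n-1, K)`. -/
def IsNormalRationalCurve {K : Type*} [Field K] {n : ℕ} (N : Set (ℙ K (Fin n → K))) : Prop :=
  ∃ g : Module.Basis (Fin n) K (MvPolynomial.homogeneousSubmodule (Fin 2) K (n - 1)), N = curve g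

section

variable (F K : Type*) [Field F] [Field K] [Algebra F K] (n : ℕ)

/-- The inclusion `Fⁿ → Kⁿ`, semilinear over `F → K`. -/
def inclusion : (Fin n → F) →ₛₗ[algebraMap F K] (Fin n → K) where
  toFun x := fun i => algebraMap F K (x i)
  map_add' x y := by ext i; simp
  map_smul' a x := by ext i; simp

theorem inclusion_injective : Function.Injective (inclusion F K n) := fun x y hxy =>
  funext fun i => (algebraMap F K).injective (congrFun hxy i)

/-- The canonical embedding `PG(n-1, F) → PG(n-1, K)`, `⟨x⟩_F ↦ ⟨x⟩_K`. -/
def subgeometryEmbedding : ℙ F (Fin n → F) → ℙ K (Fin n → K) :=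
  Projectivization.map (inclusion F K n) (inclusion_injective F K n)

/-- The canonical subgeometry `Σ`: the points of `PG(n-1, K)` spanned by a nonzero vector with
coordinates in `F`. -/
def subgeometry : Set (ℙ K (Fin n → K)) := Set.range (subgeometryEmbedding F K n)

variable [Fintype F]

/-- The map `(x₁, …, xₙ) ↦ (x₁^q, …, xₙ^q)` on `Kⁿ`, `q = |F|`, semilinear over `x ↦ x^q`. -/
def frobeniusVec :
    (Fin n → K) →ₛₗ[(FiniteField.frobeniusAlgHom F K : K →+* K)] (Fin n → K) where
  toFun x := fun i => x i ^ Fintype.card F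
  map_add' x y := by
    ext i
    exact map_add (FiniteField.frobeniusAlgHom F K) (x i) (y i)
  map_smul' a x := by
    ext i
    exact map_mul (FiniteField.frobeniusAlgHom F K) a (x i)

theorem frobeniusVec_injective : Function.Injective (frobeniusVec F K n) := fun x y hxy =>
  funext fun i => (FiniteField.frobeniusAlgHom F K).injective (congrFun hxy i)

/-- The Frobenius collineation `Ψ : ⟨(x₁, …, xₙ)⟩ ↦ ⟨(x₁^q, …, xₙ^q)⟩` of `PG(n-1, K)`,
where `q = |F|`. -/
def frobeniusCollineation : ℙ K (Fin n → K) → ℙ K (Fin n → K) :=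
  Projectivization.map (frobeniusVec F K n) (frobeniusVec_injective F K n)

end

end NRC

/-! Write n = hk and d = n - 1, and suppose n ≥ 2. Points of a curve are viewed as evaluation
functionals on binary forms of degree d, and two curves are compared through the linear map L that
carries one basis of forms to the other. The key fact is rigidity: n + 2 common points force two
curves to coincide, their parametrizations differing by a projectivity of the line. If composing L
with evaluation at `s i` gives a multiple of evaluation at `t i` for d + 3 indices, then L respects,
up to scalars, products of d linear forms vanishing at these points. Two such products differing in
one factor show that cross-ratios agree, so one matrix matches all the parameters and L is a
multiple of its substitution (`exists_matrix_of_ev`). Since PG(1,q) has q + 1 ≥ n + 2 points,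
rigidity applies to F-rational parameters.

If N meets Σ in a curve over F, extending scalars gives a Frobenius-invariant curve sharing q + 1
points with N, hence equal to N (`image_frobeniusCollineation_eq_of_inter`).

Conversely, if N is invariant, rigidity yields a semilinear map T of the parameter plane inducing Ψ
on N, and the h-th iterate of T fixes every point of the line. Surjectivity of the norm and a trace
argument provide a subline fixed by T (`exists_fixed_subline`). In coordinates adapted to it T is a
multiple of Frobenius, and a rescaled basis of forms is defined over F
(`exists_frobenius_fixed_basis`). The Σ-points of such a curve are those with F-rational parameter
(`curve_inter_subgeometry`). -/

namespace NRC

/-! ### Binary forms: evaluation, interpolation, substitution. -/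

section Forms

variable {K : Type*} [Field K]

/-- The space of binary forms of degree `d`. -/
abbrev Form (K : Type*) [Field K] (d : ℕ) : Submodule K (MvPolynomial (Fin 2) K) :=
  MvPolynomial.homogeneousSubmodule (Fin 2) K d

/-- Evaluation of binary forms at a vector, as a linear functional. -/
noncomputable def ev {d : ℕ} (v : Fin 2 → K) : Form K d →ₗ[K] K where
  toFun p := MvPolynomial.eval v (p : MvPolynomial (Fin 2) K)
  map_add' p q := by simp
  map_smul' a p := by simp [MvPolynomial.smul_eval]

theorem ev_apply {d : ℕ} (v : Fin 2 → K) (p : Form K d) :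
    ev v p = MvPolynomial.eval v (p : MvPolynomial (Fin 2) K) := rfl

/-- The determinant of two vectors of `K²`. -/
def bracket (v w : Fin 2 → K) : K := v 0 * w 1 - v 1 * w 0

theorem bracket_self (v : Fin 2 → K) : bracket v v = 0 := by
  unfold bracket; ring

theorem bracket_swap (v w : Fin 2 → K) : bracket v w = -bracket w v := by
  unfold bracket; ring

theorem ne_zero_of_bracket_ne_zero {v w : Fin 2 → K} (h : bracket v w ≠ 0) : v ≠ 0 := by
  rintro rfl; simp [bracket] at h

theorem exists_smul_of_bracket_eq_zero {v w : Fin 2 → K} (hw : w ≠ 0) (h : bracket v w = 0) :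
    ∃ a : K, v = a • w := by
  have h' : v 0 * w 1 = v 1 * w 0 := sub_eq_zero.mp h
  by_cases h0 : w 0 = 0
  · have h1 : w 1 ≠ 0 := fun h1 => hw (by ext i; fin_cases i <;> simp [h0, h1])
    refine ⟨v 1 / w 1, ?_⟩
    ext i
    fin_cases i
    · simpa [h0, h1] using h'
    · simp [h1]
  · refine ⟨v 0 / w 0, ?_⟩
    ext i
    fin_cases i
    · simp [h0]
    · simp only [Fin.mk_one, Pi.smul_apply, smul_eq_mul]
      field_simp
      exact h'.symm

/-- The linear form vanishing at `s`. -/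
noncomputable def linForm (s : Fin 2 → K) : MvPolynomial (Fin 2) K :=
  MvPolynomial.C (s 1) * MvPolynomial.X 0 - MvPolynomial.C (s 0) * MvPolynomial.X 1

theorem isHomogeneous_linForm (s : Fin 2 → K) : (linForm s).IsHomogeneous 1 := by
  refine MvPolynomial.IsHomogeneous.sub ?_ ?_ <;>
  exact (MvPolynomial.isHomogeneous_X K _).C_mul _

theorem eval_linForm (s v : Fin 2 → K) : MvPolynomial.eval v (linForm s) = bracket v s := by
  simp only [linForm, bracket, map_sub, map_mul, MvPolynomial.eval_C, MvPolynomial.eval_X]; ring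

/-- The product of the linear forms vanishing at the vectors `s i`, `i ∈ D`. -/
noncomputable def prodForm {ι : Type*} {d : ℕ} (s : ι → Fin 2 → K) (D : Finset ι)
    (hD : D.card = d) : Form K d :=
  ⟨∏ i ∈ D, linForm (s i), by
    rw [MvPolynomial.mem_homogeneousSubmodule, ← hD]
    simpa using MvPolynomial.IsHomogeneous.prod D (fun i => linForm (s i)) (fun _ => 1)
      fun i _ => isHomogeneous_linForm (s i)⟩

theorem ev_prodForm {ι : Type*} {d : ℕ} (s : ι → Fin 2 → K) (D : Finset ι) (hD : D.card = d)
    (v : Fin 2 → K) : ev v (prodForm s D hD) = ∏ i ∈ D, bracket v (s i) := by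
  simp only [ev_apply, prodForm, map_prod, eval_linForm]

theorem ev_smul {d : ℕ} (a : K) (v : Fin 2 → K) (p : Form K d) : ev (a • v) p = a ^ d * ev v p := by
  have hp := (MvPolynomial.mem_homogeneousSubmodule _ _).mp p.2
  simp only [ev_apply, MvPolynomial.eval_eq', Finset.mul_sum]
  refine Finset.sum_congr rfl fun e he => ?_
  have h := hp (MvPolynomial.mem_support_iff.mp he)
  have h2 : ∑ i, e i = d := by
    rw [← h, Finsupp.weight_apply, Finsupp.sum_fintype _ _ (by simp)]; simp
  have h3 : ∏ i, (a • v) i ^ e i = a ^ d * ∏ i, v i ^ e i := by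
    simp only [Pi.smul_apply, smul_eq_mul, mul_pow, Finset.prod_mul_distrib,
      Finset.prod_pow_eq_pow_sum, h2]
  rw [h3]; ring

/-- The vectors `s i` represent distinct points of the projective line. -/
def PairwiseIndep {ι : Type*} (s : ι → Fin 2 → K) : Prop :=
  Pairwise fun i j => bracket (s i) (s j) ≠ 0

/-- A binary form of degree `d` with `d + 1` distinct projective zeros vanishes. -/
theorem form_eq_zero {ι : Type*} {d : ℕ} (hd : Module.finrank K (Form K d) = d + 1)
    {s : ι → Fin 2 → K} (hs : PairwiseIndep s) {S : Finset ι} (hS : S.card = d + 1)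
    {p : Form K d} (hp : ∀ i ∈ S, ev (s i) p = 0) : p = 0 := by
  classical
  have : Module.Finite K (Form K d) := Module.finite_of_finrank_pos (by omega)
  let E : Form K d →ₗ[K] (S → K) := LinearMap.pi fun i => ev (s i)
  have hcard (i : S) : (S.erase i).card = d := by simp [Finset.card_erase_of_mem i.2, hS]
  -- Lagrange interpolation: the product omitting i vanishes at every other point of S. Equality of
  -- dimensions then turns surjectivity into injectivity.
  have hE : Function.Surjective E := by
    intro y
    refine ⟨∑ i : S, (y i / ∏ j ∈ S.erase i, bracket (s i) (s j)) •
      prodForm s (S.erase i) (hcard i), ?_⟩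
    ext k
    simp only [E, LinearMap.pi_apply, map_sum, map_smul, ev_prodForm, smul_eq_mul]
    rw [Finset.sum_eq_single k]
    · refine div_mul_cancel₀ _ (Finset.prod_ne_zero_iff.mpr fun j hj => hs ?_)
      exact (Finset.ne_of_mem_erase hj).symm
    · intro i _ hik
      refine mul_eq_zero_of_right _ (Finset.prod_eq_zero (i := (k : ι)) ?_ (bracket_self _))
      exact Finset.mem_erase.mpr ⟨fun h => hik (Subtype.ext h.symm), k.2⟩
    · simp
  have hinj : Function.Injective E :=
    (LinearMap.injective_iff_surjective_of_finrank_eq_finrank (by simp [hd, hS])).mpr hE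
  refine hinj (funext fun i => ?_)
  simpa [E] using hp i i.2

/-- Substitution of a matrix into a binary form. -/
noncomputable def compMatrix {d : ℕ} (B : Matrix (Fin 2) (Fin 2) K) : Form K d →ₗ[K] Form K d :=
  ((MvPolynomial.aeval fun i => ∑ j, MvPolynomial.C (B i j) * MvPolynomial.X j :
    MvPolynomial (Fin 2) K →ₐ[K] MvPolynomial (Fin 2) K).toLinearMap).restrict fun p hp => by
      have h := ((MvPolynomial.mem_homogeneousSubmodule _ _).mp hp).aeval (n := 1)
        (fun i => ∑ j, MvPolynomial.C (B i j) * MvPolynomial.X j) fun i =>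
          MvPolynomial.IsHomogeneous.sum _ _ _ fun j _ => (MvPolynomial.isHomogeneous_X K j).C_mul _
      rw [one_mul] at h
      exact (MvPolynomial.mem_homogeneousSubmodule _ _).mpr h

theorem ev_compMatrix {d : ℕ} (B : Matrix (Fin 2) (Fin 2) K) (p : Form K d) (v : Fin 2 → K) :
    ev v (compMatrix B p) = ev (B.mulVec v) p := by
  simp only [ev_apply, compMatrix, LinearMap.restrict_apply, AlgHom.toLinearMap_apply]
  rw [MvPolynomial.aeval_def]
  rw [MvPolynomial.eval₂_eq', MvPolynomial.eval_eq' (B.mulVec v)]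
  simp only [map_sum, map_mul, map_prod, map_pow,
    MvPolynomial.eval_C, MvPolynomial.eval_X, MvPolynomial.algebraMap_eq]
  rfl

theorem compMatrix_one {d : ℕ} (p : Form K d) : compMatrix 1 p = p := by
  apply Subtype.ext
  simp only [compMatrix, LinearMap.restrict_apply, AlgHom.toLinearMap_apply]
  conv_rhs => rw [← MvPolynomial.aeval_X_left_apply (p : MvPolynomial (Fin 2) K)]
  congr 2
  ext1 i
  simp only [Matrix.one_apply]
  rw [Finset.sum_eq_single i] <;> simp +contextual [eq_comm]

/-- Substitution is contravariant, hence the reversed product. -/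
theorem compMatrix_compMatrix {d : ℕ} (A B : Matrix (Fin 2) (Fin 2) K) (p : Form K d) :
    compMatrix A (compMatrix B p) = compMatrix (B * A) p := by
  have h : (MvPolynomial.aeval fun i => ∑ j, MvPolynomial.C (A i j) * MvPolynomial.X j :
      MvPolynomial (Fin 2) K →ₐ[K] MvPolynomial (Fin 2) K).comp
        (MvPolynomial.aeval fun i => ∑ j, MvPolynomial.C (B i j) * MvPolynomial.X j) =
      MvPolynomial.aeval fun i => ∑ j, MvPolynomial.C ((B * A) i j) * MvPolynomial.X j := by
    refine MvPolynomial.algHom_ext fun i => ?_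
    simp only [AlgHom.comp_apply, MvPolynomial.aeval_X, map_mul, MvPolynomial.algHom_C,
      MvPolynomial.algebraMap_eq, Matrix.mul_apply, Fin.sum_univ_two, map_add]
    ring
  exact Subtype.ext (DFunLike.congr_fun h (p : MvPolynomial (Fin 2) K))

/-- Substitution of an invertible matrix, as a linear equivalence. -/
noncomputable def compMatrixEquiv {d : ℕ} (B : Matrix (Fin 2) (Fin 2) K) (hB : B.det ≠ 0) :
    Form K d ≃ₗ[K] Form K d :=
  LinearEquiv.ofLinearMap (compMatrix B) (compMatrix B⁻¹)
    (by ext1 p; simp [compMatrix_compMatrix, Matrix.nonsing_inv_mul B hB.isUnit, compMatrix_one])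
    (by ext1 p; simp [compMatrix_compMatrix, Matrix.mul_nonsing_inv B hB.isUnit, compMatrix_one])

theorem mulVec_ne_zero {B : Matrix (Fin 2) (Fin 2) K} (hB : B.det ≠ 0) {v : Fin 2 → K}
    (hv : v ≠ 0) : B.mulVec v ≠ 0 := fun h =>
  hv (Matrix.eq_zero_of_mulVec_eq_zero hB h)

end Forms

/-! ### Extension of scalars for binary forms. -/

section BaseChange

variable {F K : Type*} [Field F] [Field K]

/-- Extension of scalars of binary forms along a field homomorphism. -/
noncomputable def mapForm {d : ℕ} (φ : F →+* K) (p : Form F d) : Form K d :=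
  ⟨MvPolynomial.map φ (p : MvPolynomial (Fin 2) F),
    (MvPolynomial.mem_homogeneousSubmodule _ _).mpr
      (((MvPolynomial.mem_homogeneousSubmodule _ _).mp p.2).map φ)⟩

theorem ev_mapForm {d : ℕ} (φ : F →+* K) (p : Form F d) (v : Fin 2 → F) :
    ev (fun i => φ (v i)) (mapForm φ p) = φ (ev v p) := by
  rw [ev_apply, ev_apply, mapForm, MvPolynomial.eval_map]
  simp only [MvPolynomial.eval₂_eq', MvPolynomial.eval_eq', map_sum, map_mul, map_prod, map_pow]

theorem mapForm_sum_smul {ι : Type*} {d : ℕ} (φ : F →+* K) (s : Finset ι) (a : ι → F)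
    (p : ι → Form F d) :
    mapForm φ (∑ i ∈ s, a i • p i) = ∑ i ∈ s, φ (a i) • mapForm φ (p i) := by
  apply Subtype.ext
  simp [mapForm, MvPolynomial.smul_eq_C_mul]

theorem mapForm_injective {d : ℕ} (φ : F →+* K) :
    Function.Injective (mapForm φ : Form F d → Form K d) := fun _ _ h =>
  Subtype.ext (MvPolynomial.map_injective φ φ.injective (congrArg Subtype.val h))

/-- The image of a basis of binary forms under a field homomorphism spans. -/
theorem top_le_span_mapForm {ι : Type*} [Fintype ι] {d : ℕ} (φ : F →+* K)
    (m : Module.Basis ι F (Form F d)) :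
    ⊤ ≤ Submodule.span K (Set.range fun i => mapForm φ (m i)) := by
  classical
  rintro p -
  have hp := (MvPolynomial.mem_homogeneousSubmodule _ _).mp p.2
  have hmem (e : Fin 2 →₀ ℕ) (he : e ∈ (p : MvPolynomial (Fin 2) K).support) :
      MvPolynomial.monomial e (1 : F) ∈ Form F d :=
    (MvPolynomial.mem_homogeneousSubmodule _ _).mpr (MvPolynomial.isHomogeneous_monomial _
      (by simpa [Finsupp.weight_apply, Finsupp.degree_apply, Finsupp.sum] using
        hp (MvPolynomial.mem_support_iff.mp he)))
  have hsum : p = ∑ e ∈ (p : MvPolynomial (Fin 2) K).support.attach,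
      MvPolynomial.coeff (e : Fin 2 →₀ ℕ) (p : MvPolynomial (Fin 2) K) •
        mapForm φ ⟨_, hmem e e.2⟩ := by
    apply Subtype.ext
    conv_lhs => rw [MvPolynomial.as_sum (p : MvPolynomial (Fin 2) K), ← Finset.sum_attach]
    simp [mapForm, MvPolynomial.smul_monomial]
  rw [hsum]
  refine Submodule.sum_mem _ fun e _ => Submodule.smul_mem _ _ ?_
  rw [← m.sum_repr ⟨_, hmem e e.2⟩, mapForm_sum_smul]
  exact Submodule.sum_mem _ fun i _ =>
    Submodule.smul_mem _ _ (Submodule.subset_span (Set.mem_range_self i))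

/-- The basis of binary forms over `K` obtained from one over `F`. -/
noncomputable def mapBasis {n d : ℕ} (φ : F →+* K) (hd : Module.finrank K (Form K d) = n)
    (m : Module.Basis (Fin n) F (Form F d)) : Module.Basis (Fin n) K (Form K d) :=
  basisOfTopLeSpanOfCardEqFinrank _ (top_le_span_mapForm φ m) (by simp [hd])

theorem mapBasis_apply {n d : ℕ} (φ : F →+* K) (hd : Module.finrank K (Form K d) = n)
    (m : Module.Basis (Fin n) F (Form F d)) (i : Fin n) :
    mapBasis φ hd m i = mapForm φ (m i) := by
  simp [mapBasis]

end BaseChange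

/-! ### Rigidity: linear maps of forms determined by d + 3 points. -/

section Uniqueness

variable {K : Type*} [Field K] {ι : Type*} {d : ℕ}

/-- If a linear map of binary forms carries evaluation at `s i` to a multiple of evaluation at
`t i`, then it maps the product of the linear forms vanishing at `t i`, `i ∈ D`, to a multiple
of the corresponding product for `s`. -/
theorem exists_map_prodForm (hd : Module.finrank K (Form K d) = d + 1)
    (L : Form K d →ₗ[K] Form K d) {s t : ι → Fin 2 → K} {c : ι → K} (hs : PairwiseIndep s)
    (hL : ∀ i p, ev (s i) (L p) = c i * ev (t i) p) (D : Finset ι) (hD : D.card = d)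
    {b : ι} (hb : b ∉ D) :
    ∃ κ : K, L (prodForm t D hD) = κ • prodForm s D hD := by
  classical
  have hne : ev (s b) (prodForm s D hD) ≠ 0 := by
    rw [ev_prodForm]
    exact Finset.prod_ne_zero_iff.mpr fun i hi => hs (ne_of_mem_of_not_mem hi hb).symm
  -- The scalar is fitted at the extra point b; the difference then vanishes at the d points of D
  -- and at b.
  refine ⟨ev (s b) (L (prodForm t D hD)) / ev (s b) (prodForm s D hD), sub_eq_zero.mp ?_⟩
  refine form_eq_zero hd hs (S := insert b D) (by simp [hb, hD]) fun i hi => ?_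
  rw [map_sub, map_smul, smul_eq_mul]
  rcases Finset.mem_insert.mp hi with rfl | hi
  · rw [div_mul_cancel₀ _ hne, sub_self]
  · have h0 (r : ι → Fin 2 → K) : ev (r i) (prodForm r D hD) = 0 := by
      rw [ev_prodForm, Finset.prod_eq_zero hi (bracket_self _)]
    rw [hL, h0, h0, mul_zero, mul_zero, sub_self]

theorem exists_finset_card_disjoint [Fintype ι] [DecidableEq ι] (A : Finset ι) {m : ℕ}
    (h : A.card + m ≤ Fintype.card ι) : ∃ I : Finset ι, I.card = m ∧ ∀ i ∈ A, i ∉ I := by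
  obtain ⟨I, hI, hcard⟩ := Finset.exists_subset_card_eq (s := Aᶜ) (n := m)
    (by rw [Finset.card_compl]; omega)
  exact ⟨I, hcard, fun i hi h => Finset.mem_compl.mp (hI h) hi⟩

/-- A linear map of binary forms of degree `d` having the evaluations at `d + 2` distinct
projective points as eigenvectors is a scalar. -/
theorem eq_smul_of_ev_eigen [Fintype ι] (hd : Module.finrank K (Form K d) = d + 1)
    (hcard : d + 2 ≤ Fintype.card ι)
    (L : Form K d →ₗ[K] Form K d) {s : ι → Fin 2 → K} {c : ι → K} (hs : PairwiseIndep s)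
    (hL : ∀ i p, ev (s i) (L p) = c i * ev (s i) p) :
    ∃ κ : K, (∀ i, c i = κ) ∧ ∀ p, L p = κ • p := by
  classical
  have hc : ∀ i j, c i = c j := by
    intro i j
    by_cases hij : i = j
    · rw [hij]
    -- The product over D is an eigenvector nonvanishing at both i and j, so both eigenvalues equal
    -- its own. This needs d + 2 points.
    obtain ⟨D, hD, hDn⟩ := exists_finset_card_disjoint ({i, j} : Finset ι) (m := d)
      (by rw [Finset.card_pair hij]; omega)
    have hi : i ∉ D := hDn i (by simp)
    have hj : j ∉ D := hDn j (by simp)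
    obtain ⟨κ, hκ⟩ := exists_map_prodForm hd L hs hL D hD hi
    have key : ∀ k, k ∉ D → c k = κ := by
      intro k hk
      have hne : ev (s k) (prodForm s D hD) ≠ 0 := by
        rw [ev_prodForm]
        exact Finset.prod_ne_zero_iff.mpr fun i hi => hs (ne_of_mem_of_not_mem hi hk).symm
      have h := hL k (prodForm s D hD)
      rw [hκ, map_smul, smul_eq_mul] at h
      exact (mul_right_cancel₀ hne h).symm
    rw [key i hi, key j hj]
  obtain ⟨i₀⟩ : Nonempty ι := Fintype.card_pos_iff.mp (by omega)
  refine ⟨c i₀, fun i => hc i i₀, fun p => sub_eq_zero.mp ?_⟩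
  obtain ⟨S, -, hS⟩ := Finset.exists_subset_card_eq (s := (Finset.univ : Finset ι)) (n := d + 1)
    (by rw [Finset.card_univ]; omega)
  refine form_eq_zero hd hs hS fun i _ => ?_
  rw [map_sub, map_smul, smul_eq_mul, hL, hc i i₀, sub_self]

/-- Corresponding quadruples of points on two normal rational curves sharing enough points
have the same cross-ratio. -/
theorem cross_ratio_eq [Fintype ι] (hd : Module.finrank K (Form K d) = d + 1) (hd1 : 1 ≤ d)
    (hcard : d + 3 ≤ Fintype.card ι) (L : Form K d →ₗ[K] Form K d)
    {s t : ι → Fin 2 → K} {c : ι → K} (hs : PairwiseIndep s) (ht : PairwiseIndep t)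
    (hc : ∀ i, c i ≠ 0) (hL : ∀ i p, ev (s i) (L p) = c i * ev (t i) p)
    {i j k l : ι} (hik : i ≠ k) (hil : i ≠ l) :
    bracket (t i) (t k) * bracket (t j) (t l) * (bracket (s j) (s k) * bracket (s i) (s l)) =
      bracket (t j) (t k) * bracket (t i) (t l) *
        (bracket (s i) (s k) * bracket (s j) (s l)) := by
  classical
  -- The d - 1 factors over I are common to the two products of degree d, which differ only in k
  -- versus l. Avoiding four indices uses (d - 1) + 4 = d + 3 points.
  obtain ⟨I, hI, hIn⟩ := exists_finset_card_disjoint ({i, j, k, l} : Finset ι) (m := d - 1) (by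
    have : ({i, j, k, l} : Finset ι).card ≤ 4 := Finset.card_le_four
    omega)
  have hi : i ∉ I := hIn i (by simp)
  have hj : j ∉ I := hIn j (by simp)
  have hk : k ∉ I := hIn k (by simp)
  have hl : l ∉ I := hIn l (by simp)
  have hIk : (insert k I).card = d := by rw [Finset.card_insert_of_notMem hk]; omega
  have hIl : (insert l I).card = d := by rw [Finset.card_insert_of_notMem hl]; omega
  obtain ⟨κ, hκ⟩ := exists_map_prodForm hd L hs hL (insert k I) hIk (b := i) (by simp [hik, hi])
  obtain ⟨ν, hν⟩ := exists_map_prodForm hd L hs hL (insert l I) hIl (b := i) (by simp [hil, hi])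
  have e1 := hL i (prodForm t (insert k I) hIk)
  have e2 := hL j (prodForm t (insert k I) hIk)
  have e3 := hL i (prodForm t (insert l I) hIl)
  have e4 := hL j (prodForm t (insert l I) hIl)
  simp only [hκ, hν, map_smul, smul_eq_mul, ev_prodForm, Finset.prod_insert hk,
    Finset.prod_insert hl] at e1 e2 e3 e4
  have hPi : ∏ m ∈ I, bracket (t i) (t m) ≠ 0 :=
    Finset.prod_ne_zero_iff.mpr fun m hm => ht (ne_of_mem_of_not_mem hm hi).symm
  have hPj : ∏ m ∈ I, bracket (t j) (t m) ≠ 0 :=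
    Finset.prod_ne_zero_iff.mpr fun m hm => ht (ne_of_mem_of_not_mem hm hj).symm
  generalize ∏ m ∈ I, bracket (t i) (t m) = Pi at *
  generalize ∏ m ∈ I, bracket (t j) (t m) = Pj at *
  generalize ∏ m ∈ I, bracket (s i) (s m) = Qi at *
  generalize ∏ m ∈ I, bracket (s j) (s m) = Qj at *
  -- Both `h1` and `h2` carry the same unknown factor on the right; cross-multiplying removes it and
  -- leaves the cross-ratios.
  have h1 : (c i * Pi) * (c j * Pj) * (bracket (t i) (t k) * bracket (t j) (t l)) =
      κ * ν * Qi * Qj * (bracket (s i) (s k) * bracket (s j) (s l)) := by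
    linear_combination (-(c j * (bracket (t j) (t l) * Pj))) * e1 -
      (κ * (bracket (s i) (s k) * Qi)) * e4
  have h2 : (c i * Pi) * (c j * Pj) * (bracket (t j) (t k) * bracket (t i) (t l)) =
      κ * ν * Qi * Qj * (bracket (s j) (s k) * bracket (s i) (s l)) := by
    linear_combination (-(c i * (bracket (t i) (t l) * Pi))) * e2 -
      (κ * (bracket (s j) (s k) * Qj)) * e3
  refine mul_left_cancel₀ (mul_ne_zero (mul_ne_zero (hc i) hPi) (mul_ne_zero (hc j) hPj)) ?_
  linear_combination (bracket (s j) (s k) * bracket (s i) (s l)) * h1 -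
    (bracket (s i) (s k) * bracket (s j) (s l)) * h2

/-- A linear map of binary forms carrying the evaluations at `d + 3` distinct projective points to
multiples of the evaluations at `d + 3` distinct projective points is, up to a scalar, the
substitution of an invertible matrix. -/
theorem exists_matrix_of_ev [Fintype ι] (hd : Module.finrank K (Form K d) = d + 1) (hd1 : 1 ≤ d)
    (hcard : d + 3 ≤ Fintype.card ι) (L : Form K d →ₗ[K] Form K d)
    {s t : ι → Fin 2 → K} {c : ι → K} (hs : PairwiseIndep s) (ht : PairwiseIndep t)
    (hc : ∀ i, c i ≠ 0) (hL : ∀ i p, ev (s i) (L p) = c i * ev (t i) p) :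
    ∃ (B : Matrix (Fin 2) (Fin 2) K) (κ : K), B.det ≠ 0 ∧ κ ≠ 0 ∧
      ∀ v p, ev v (L p) = κ * ev (B.mulVec v) p := by
  classical
  obtain ⟨i, j, k, hij, hik, hjk⟩ := Fintype.two_lt_card_iff.mp (show 2 < Fintype.card ι by omega)
  -- These weights make B send `s i`, `s j`, `s k` to multiples of `t i`, `t j`, `t k`; for k this
  -- is the identity [t_i,t_j] t_k = [t_k,t_j] t_i + [t_i,t_k] t_j.
  set α := bracket (t k) (t j) * bracket (s i) (s k) with hα
  set β := bracket (t i) (t k) * bracket (s k) (s j) with hβ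
  have hα0 : α ≠ 0 := mul_ne_zero (ht hjk.symm) (hs hik)
  have hβ0 : β ≠ 0 := mul_ne_zero (ht hik) (hs hjk.symm)
  let B : Matrix (Fin 2) (Fin 2) K :=
    Matrix.of fun x y => α * t i x * ![s j 1, -s j 0] y + β * t j x * ![-s i 1, s i 0] y
  have hBv (v w : Fin 2 → K) : bracket (B.mulVec v) w =
      bracket v (s j) * α * bracket (t i) w + bracket (s i) v * β * bracket (t j) w := by
    simp only [bracket, B, Matrix.mulVec, dotProduct, Fin.sum_univ_two, Matrix.of_apply,
      Matrix.cons_val_zero, Matrix.cons_val_one]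
    ring
  have hdet : B.det ≠ 0 := by
    have h : B.det = α * β * (bracket (s i) (s j) * bracket (t i) (t j)) := by
      simp only [bracket, B, Matrix.det_fin_two, Matrix.of_apply,
        Matrix.cons_val_zero, Matrix.cons_val_one]
      ring
    rw [h]
    exact mul_ne_zero (mul_ne_zero hα0 hβ0) (mul_ne_zero (hs hij) (ht hij))
  have hB (l : ι) : bracket (t l) (B.mulVec (s l)) = 0 := by
    rw [bracket_swap, hBv, neg_eq_zero]
    by_cases hli : l = i
    · subst hli; simp [bracket_self]
    have h := cross_ratio_eq hd hd1 hcard L hs ht hc hL (j := j) hik (Ne.symm hli)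
    rw [hα, hβ, bracket_swap (s l), bracket_swap (t k) (t j), bracket_swap (s k) (s j)]
    linear_combination -h
  have hs0 (l : ι) : s l ≠ 0 := by
    obtain ⟨m, hm⟩ := Fintype.exists_ne_of_one_lt_card (show 1 < Fintype.card ι by omega) l
    exact ne_zero_of_bracket_ne_zero (hs hm.symm)
  have ht0 (l : ι) : t l ≠ 0 := by
    obtain ⟨m, hm⟩ := Fintype.exists_ne_of_one_lt_card (show 1 < Fintype.card ι by omega) l
    exact ne_zero_of_bracket_ne_zero (ht hm.symm)
  choose δ hδ using fun l => exists_smul_of_bracket_eq_zero (mulVec_ne_zero hdet (hs0 l)) (hB l)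
  have hδ0 (l : ι) : δ l ≠ 0 := fun h => ht0 l (by rw [hδ l, h, zero_smul])
  -- Undoing the substitution of B leaves a map with every evaluation at `s l` as an eigenvector,
  -- hence a scalar.
  obtain ⟨κ, hκ, hM⟩ := eq_smul_of_ev_eigen (c := fun l => c l * δ l ^ d) hd (by omega)
    (L ∘ₗ (compMatrixEquiv B hdet).symm.toLinearMap) hs (by
      intro l p
      obtain ⟨p, rfl⟩ := (compMatrixEquiv B hdet).surjective p
      have h : (compMatrixEquiv B hdet) p = compMatrix B p := rfl
      rw [LinearMap.comp_apply, LinearEquiv.coe_coe, LinearEquiv.symm_apply_apply, hL, h,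
        ev_compMatrix, hδ l, ev_smul, mul_assoc])
  refine ⟨B, κ, hdet, ?_, fun v p => ?_⟩
  · rw [← hκ i]
    exact mul_ne_zero (hc i) (pow_ne_zero d (hδ0 i))
  · have h := hM (compMatrixEquiv B hdet p)
    rw [LinearMap.comp_apply, LinearEquiv.coe_coe, LinearEquiv.symm_apply_apply] at h
    rw [h, map_smul, smul_eq_mul, ← ev_compMatrix]
    rfl

end Uniqueness

/-! ### Normal rational curves and their parametrizations. -/

section Curves

variable {K : Type*} [Field K] {n : ℕ}

theorem mem_curve_iff (g : Module.Basis (Fin n) K (Form K (n - 1))) {x : Fin n → K} (hx : x ≠ 0) :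
    Projectivization.mk K x hx ∈ curve g ↔
      ∃ v : Fin 2 → K, v ≠ 0 ∧ ∃ a : K, ∀ i, x i = a * ev v (g i) := by
  constructor
  · rintro ⟨v, hv, h⟩
    obtain ⟨a, ha⟩ := (Projectivization.mk_eq_mk_iff' K _ _ _ _).mp h
    exact ⟨v, hv, a, fun i => (congrFun ha i).symm⟩
  · rintro ⟨v, hv, a, ha⟩
    exact ⟨v, hv, (Projectivization.mk_eq_mk_iff' K _ _ _ _).mpr
      ⟨a, funext fun i => (ha i).symm⟩⟩

theorem exists_ev_ne_zero (g : Module.Basis (Fin n) K (Form K (n - 1))) {v : Fin 2 → K}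
    (hv : v ≠ 0) : ∃ i, ev v (g i) ≠ 0 :=
  Function.ne_iff.mp (eval_basis_ne_zero g v hv)

theorem finrank_form (g : Module.Basis (Fin n) K (Form K (n - 1))) :
    Module.finrank K (Form K (n - 1)) = n := by
  simpa using Module.finrank_eq_card_basis g

/-- Functionals agreeing on a basis agree, so coordinatewise proportionality of two curve points
becomes a statement about one linear map on all forms. -/
theorem ev_equiv_of_ev_basis {d : ℕ} (g g' : Module.Basis (Fin n) K (Form K d)) {v w : Fin 2 → K}
    {c : K} (h : ∀ i, ev v (g' i) = c * ev w (g i)) (p : Form K d) :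
    ev v (g.equiv g' (Equiv.refl _) p) = c * ev w p := by
  have h' : ev v ∘ₗ (g.equiv g' (Equiv.refl _)).toLinearMap = c • ev w :=
    g.ext fun i => by simpa using h i
  exact DFunLike.congr_fun h' p

/-- The parametrization of a normal rational curve is injective. -/
theorem bracket_eq_zero_of_ev {d : ℕ} (hd : 1 ≤ d) (g : Module.Basis (Fin n) K (Form K d))
    {v w : Fin 2 → K} {c : K} (h : ∀ i, ev v (g i) = c * ev w (g i)) : bracket v w = 0 := by
  -- Test on the d-th power of the linear form vanishing at w.
  have h' := ev_equiv_of_ev_basis g g h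
    (prodForm (fun _ : Fin d => w) Finset.univ (by simp))
  simp only [Module.Basis.equiv_refl, LinearEquiv.refl_apply, ev_prodForm, bracket_self,
    Finset.prod_const, Finset.card_univ, Fintype.card_fin] at h'
  rw [zero_pow (by omega), mul_zero] at h'
  exact pow_eq_zero_iff (by omega) |>.mp h'

/-- Two normal rational curves of `PG(n-1, K)` sharing `n + 2` points are, up to a scalar, related
by a projectivity of the parameter line. -/
theorem exists_matrix_of_mem_curve {ι : Type*} [Fintype ι] (hn : 2 ≤ n)
    (hcard : n + 2 ≤ Fintype.card ι) (g g' : Module.Basis (Fin n) K (Form K (n - 1)))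
    {s : ι → Fin 2 → K} (hs : PairwiseIndep s)
    (h : ∀ i, ∃ t : Fin 2 → K, ∃ a : K, ∀ j, ev (s i) (g' j) = a * ev t (g j)) :
    ∃ (B : Matrix (Fin 2) (Fin 2) K) (κ : K), B.det ≠ 0 ∧ κ ≠ 0 ∧
      ∀ v j, ev v (g' j) = κ * ev (B.mulVec v) (g j) := by
  choose t c htc using h
  have hs0 (l : ι) : s l ≠ 0 := by
    obtain ⟨m, hm⟩ := Fintype.exists_ne_of_one_lt_card (show 1 < Fintype.card ι by omega) l
    exact ne_zero_of_bracket_ne_zero (hs hm.symm)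
  have hc (l : ι) : c l ≠ 0 := by
    intro h0
    obtain ⟨j, hj⟩ := exists_ev_ne_zero g' (hs0 l)
    exact hj (by rw [htc, h0, zero_mul])
  have ht0 (l : ι) : t l ≠ 0 := by
    intro h0
    obtain ⟨j, hj⟩ := exists_ev_ne_zero g' (hs0 l)
    refine hj ?_
    have h2 := ev_smul (0 : K) 0 (g j)
    rw [smul_zero, zero_pow (by omega), zero_mul] at h2
    rw [htc, h0, h2, mul_zero]
  have ht : PairwiseIndep t := by
    intro i j hij h0
    obtain ⟨a, ha⟩ := exists_smul_of_bracket_eq_zero (ht0 j) h0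
    refine hs hij (bracket_eq_zero_of_ev (by omega) g' (c := c i * a ^ (n - 1) / c j) fun m => ?_)
    rw [htc i, htc j, ha, ev_smul]
    field_simp [hc j]
  obtain ⟨B, κ, hB, hκ, hBκ⟩ := exists_matrix_of_ev (by rw [finrank_form g]; omega) (by omega)
    (by omega) (g.equiv g' (Equiv.refl _)).toLinearMap hs ht hc
    fun i p => ev_equiv_of_ev_basis g g' (htc i) p
  refine ⟨B, κ, hB, hκ, fun v j => ?_⟩
  simpa using hBκ v (g j)

/-- An invertible B permutes the points of the parameter line, so it only reparametrizes the curve.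
-/
theorem curve_eq_of_matrix (g g' : Module.Basis (Fin n) K (Form K (n - 1)))
    {B : Matrix (Fin 2) (Fin 2) K} {κ : K} (hB : B.det ≠ 0) (hκ : κ ≠ 0)
    (h : ∀ v j, ev v (g' j) = κ * ev (B.mulVec v) (g j)) : curve g' = curve g := by
  ext P
  induction P using Projectivization.ind with | h x hx => ?_
  rw [mem_curve_iff, mem_curve_iff]
  constructor
  · rintro ⟨v, hv, a, ha⟩
    exact ⟨B.mulVec v, mulVec_ne_zero hB hv, a * κ, fun i => by rw [ha, h, mul_assoc]⟩
  · rintro ⟨v, hv, a, ha⟩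
    have hinv : B.mulVec (B⁻¹.mulVec v) = v := by
      rw [Matrix.mulVec_mulVec, Matrix.mul_nonsing_inv B hB.isUnit, Matrix.one_mulVec]
    refine ⟨B⁻¹.mulVec v, ?_, a * κ⁻¹, fun i => ?_⟩
    · intro h0
      rw [h0, Matrix.mulVec_zero] at hinv
      exact hv hinv.symm
    · rw [h, hinv, ha]; field_simp

/-- Representatives of the points of the projective line over `F`. -/
def linePoints (F : Type*) [Field F] : Option F → Fin 2 → F
  | none => ![1, 0]
  | some a => ![a, 1]

theorem pairwiseIndep_linePoints (F : Type*) [Field F] : PairwiseIndep (linePoints F) := by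
  rintro (_ | a) (_ | b) hab
  · exact absurd rfl hab
  · simp [linePoints, bracket]
  · simp [linePoints, bracket]
  · have : a ≠ b := fun h => hab (by rw [h])
    simpa [linePoints, bracket] using sub_ne_zero.mpr this

theorem PairwiseIndep.map {F ι : Type*} [Field F] (φ : F →+* K) {s : ι → Fin 2 → F}
    (hs : PairwiseIndep s) : PairwiseIndep fun i j => φ (s i j) := by
  intro i j hij
  have h : bracket (fun m => φ (s i m)) (fun m => φ (s j m)) = φ (bracket (s i) (s j)) := by
    simp [bracket]
  exact h ▸ (map_ne_zero φ).mpr (hs hij)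

end Curves

/-! ### The Frobenius action on curves and its fixed field. -/

section Frobenius

variable (F : Type*) {K : Type*} [Field F] [Field K] [Algebra F K] [Fintype F] {n : ℕ}

/-- The Frobenius collineation maps the curve of `g` to the curve of the conjugate basis. -/
theorem image_frobeniusCollineation_curve [Finite K] (g : Module.Basis (Fin n) K (Form K (n - 1))) :
    frobeniusCollineation F K n '' curve g =
      curve (mapBasis (FiniteField.frobeniusAlgHom F K : K →+* K) (finrank_form g) g) := by
  set φ : K →+* K := (FiniteField.frobeniusAlgHom F K : K →+* K) with hφ
  have hsurj : Function.Surjective φ := Finite.surjective_of_injective φ.injective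
  ext P
  constructor
  · rintro ⟨_, ⟨v, hv, rfl⟩, rfl⟩
    refine ⟨fun i => φ (v i), fun h => hv (funext fun i => φ.injective ?_), ?_⟩
    · simpa using congrFun h i
    · rw [frobeniusCollineation, Projectivization.map_mk]
      congr 1
      funext i
      rw [← ev_apply, mapBasis_apply, ev_mapForm]
      rfl
  · rintro ⟨v, hv, rfl⟩
    choose w hw using fun i => hsurj (v i)
    obtain rfl : (fun i => φ (w i)) = v := funext hw
    refine ⟨_, ⟨w, ?_, rfl⟩, ?_⟩
    · rintro rfl
      exact hv (by ext; simp)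
    · rw [frobeniusCollineation, Projectivization.map_mk]
      congr 1
      funext i
      rw [← ev_apply, mapBasis_apply, ev_mapForm]
      rfl

/-- A normal rational curve with a parametrization fixed by the Frobenius map is invariant under
the Frobenius collineation. -/
theorem image_frobeniusCollineation_curve_eq [Finite K]
    (g : Module.Basis (Fin n) K (Form K (n - 1)))
    (hg : ∀ j, mapForm (FiniteField.frobeniusAlgHom F K : K →+* K) (g j) = g j) :
    frobeniusCollineation F K n '' curve g = curve g := by
  rw [image_frobeniusCollineation_curve]
  congr 1
  exact Module.Basis.eq_of_apply_eq fun j => by rw [mapBasis_apply, hg]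

/-- The q elements of F already exhaust the roots of X^q - X in K. -/
theorem exists_algebraMap_eq_of_pow_card_eq {x : K} (hx : x ^ Fintype.card F = x) :
    ∃ y : F, algebraMap F K y = x := by
  classical
  have hq : 1 < Fintype.card F := Fintype.one_lt_card
  have hne := FiniteField.X_pow_card_sub_X_ne_zero K hq
  have hsub : Finset.univ.image (algebraMap F K) ⊆
      (Polynomial.X ^ Fintype.card F - Polynomial.X : Polynomial K).roots.toFinset := by
    intro z hz
    obtain ⟨y, -, rfl⟩ := Finset.mem_image.mp hz
    rw [Multiset.mem_toFinset, Polynomial.mem_roots hne]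
    simp [← map_pow, FiniteField.pow_card]
  have heq := Finset.eq_of_subset_of_card_le hsub (by
    rw [Finset.card_image_of_injective _ (algebraMap F K).injective, Finset.card_univ]
    refine (Multiset.toFinset_card_le _).trans ((Polynomial.card_roots' _).trans ?_)
    rw [FiniteField.X_pow_card_sub_X_natDegree_eq K hq])
  have hmem : x ∈ Finset.univ.image (algebraMap F K) := by
    rw [heq, Multiset.mem_toFinset, Polynomial.mem_roots hne]
    simp [hx]
  obtain ⟨y, -, hy⟩ := Finset.mem_image.mp hmem
  exact ⟨y, hy⟩

end Frobenius

/-! ### Galois descent for semilinear maps of the parameter plane. -/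

section Semilinear

variable {K : Type*} [Field K] {q : ℕ}

theorem iterate_semilinear {V : Type*} [AddCommGroup V] [Module K V] (T : V →+ V)
    (hT : ∀ (a : K) v, T (a • v) = a ^ q • T v) (m : ℕ) (a : K) (v : V) :
    T^[m] (a • v) = a ^ q ^ m • T^[m] v := by
  induction m generalizing a v with
  | zero => simp
  | succ m ih => rw [Function.iterate_succ_apply, hT, ih, ← pow_mul, ← pow_succ',
      Function.iterate_succ_apply]

/-- A linear map fixing every line through the origin is scalar: (1,0) and (0,1) make it diagonal,
and (1,1) equates the two entries. -/
theorem exists_smul_eq_of_bracket_eq_zero (S : (Fin 2 → K) →+ (Fin 2 → K))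
    (hS : ∀ (a : K) v, S (a • v) = a • S v) (h : ∀ v, bracket (S v) v = 0) :
    ∃ τ : K, ∀ v, S v = τ • v := by
  have h0 : (![1, 0] : Fin 2 → K) ≠ 0 := fun h => by simpa using congrFun h 0
  have h1 : (![0, 1] : Fin 2 → K) ≠ 0 := fun h => by simpa using congrFun h 1
  obtain ⟨x, hx⟩ := exists_smul_of_bracket_eq_zero h0 (h _)
  obtain ⟨y, hy⟩ := exists_smul_of_bracket_eq_zero h1 (h _)
  have hv (v : Fin 2 → K) : S v = ![x * v 0, y * v 1] := by
    have hdec : v = v 0 • ![1, 0] + v 1 • ![0, 1] := by ext i; fin_cases i <;> simp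
    conv_lhs => rw [hdec, map_add, hS, hS, hx, hy]
    ext i; fin_cases i <;> simp [mul_comm]
  have hxy : x = y := by
    have := h ![1, 1]
    rw [hv] at this
    simpa [bracket, sub_eq_zero] using this
  refine ⟨x, fun v => ?_⟩
  rw [hv, ← hxy]
  ext i; fin_cases i <;> simp

/-- A `q`-semilinear map of `K²` of order dividing `h`, `|K| = q ^ h`, has fixed vectors outside
every line. -/
theorem exists_fixed_bracket_ne_zero [Fintype K] {h : ℕ} (hq : 2 ≤ q) (hh : 0 < h)
    (hK : Fintype.card K = q ^ h) (T : (Fin 2 → K) →+ (Fin 2 → K))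
    (hT : ∀ (a : K) v, T (a • v) = a ^ q • T v) (hTh : ∀ v, T^[h] v = v)
    {u : Fin 2 → K} (hu : u ≠ 0) : ∃ w, T w = w ∧ bracket w u ≠ 0 := by
  classical
  obtain ⟨v, hv⟩ : ∃ v : Fin 2 → K, bracket v u ≠ 0 := by
    by_contra! hcon
    refine hu (funext fun i => ?_)
    have h0 := hcon ![1, 0]
    have h1 := hcon ![0, 1]
    fin_cases i <;> simp_all [bracket]
  -- The value of P at a is the bracket with u of the trace Σ T^i(av). Its linear coefficient is
  -- [v,u] ≠ 0 and its degree is at most q^(h-1) < |K|, so some trace lies off the line of u.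
  let P : Polynomial K :=
    ∑ i ∈ Finset.range h, Polynomial.C (bracket (T^[i] v) u) * Polynomial.X ^ q ^ i
  have hP : P ≠ 0 := by
    intro hP0
    have hc := congrArg (fun Q : Polynomial K => Q.coeff 1) hP0
    simp only [P, Polynomial.finsetSum_coeff, Polynomial.coeff_C_mul, Polynomial.coeff_X_pow,
      Polynomial.coeff_zero] at hc
    rw [Finset.sum_eq_single 0] at hc
    · exact hv (by simpa using hc)
    · intro i _ hi
      rw [if_neg, mul_zero]
      exact (Nat.one_lt_pow hi hq).ne
    · intro h0; exact absurd (Finset.mem_range.mpr hh) h0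
  have hdeg : P.natDegree < Fintype.card K := by
    rw [hK]
    refine lt_of_le_of_lt (b := q ^ (h - 1)) ?_ (Nat.pow_lt_pow_right hq (by omega))
    refine Polynomial.natDegree_sum_le_of_forall_le _ _ fun i hi => ?_
    refine (Polynomial.natDegree_C_mul_X_pow_le _ _).trans ?_
    have := Finset.mem_range.mp hi
    exact Nat.pow_le_pow_right (by omega) (by omega)
  obtain ⟨a, ha⟩ : ∃ a, P.eval a ≠ 0 := by
    by_contra! hcon
    exact hP (Polynomial.eq_zero_of_natDegree_lt_card_of_eval_eq_zero P Function.injective_id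
      (fun a => hcon a) hdeg)
  refine ⟨∑ i ∈ Finset.range h, T^[i] (a • v), ?_, ?_⟩
  -- T shifts the summands cyclically, because its h-th iterate is the identity.
  · rw [map_sum]
    simp only [← Function.iterate_succ_apply' T]
    have h1 := Finset.sum_range_succ (fun i => T^[i] (a • v)) h
    rw [Finset.sum_range_succ', hTh, Function.iterate_zero_apply] at h1
    exact add_right_cancel h1
  · convert ha using 1
    have hb (i : ℕ) : bracket (T^[i] (a • v)) u = bracket (T^[i] v) u * a ^ q ^ i := by
      rw [iterate_semilinear T hT]
      simp only [bracket, Pi.smul_apply, smul_eq_mul]; ring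
    simp only [P, Polynomial.eval_finsetSum, Polynomial.eval_mul, Polynomial.eval_C,
      Polynomial.eval_pow, Polynomial.eval_X, ← hb]
    simp only [bracket, Finset.sum_apply, Finset.sum_mul, Finset.sum_sub_distrib]

/-- A Frobenius-semilinear bijection of `K²` whose `h`-th iterate fixes every projective point,
`h = [K : F]`, fixes the points of a subline over `F`. -/
theorem exists_fixed_subline (F : Type*) [Field F] [Fintype F] [Fintype K] [Algebra F K]
    {h : ℕ} (hh : 0 < h) (hK : Fintype.card K = Fintype.card F ^ h)
    (T : (Fin 2 → K) →+ (Fin 2 → K)) (hT : ∀ (a : K) v, T (a • v) = a ^ Fintype.card F • T v)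
    (hT0 : ∀ v, T v = 0 → v = 0) (hTh : ∀ v, bracket (T^[h] v) v = 0) :
    ∃ (ν : K) (w₁ w₂ : Fin 2 → K), bracket w₁ w₂ ≠ 0 ∧ T w₁ = ν • w₁ ∧ T w₂ = ν • w₂ := by
  have hq : 2 ≤ Fintype.card F := Fintype.one_lt_card
  have hpow (a : K) : a ^ Fintype.card F ^ h = a := by rw [← hK, FiniteField.pow_card]
  have hfin : Module.finrank F K = h := by
    have := Module.card_eq_pow_finrank (K := F) (V := K)
    rw [hK] at this
    exact (Nat.pow_right_injective hq this).symm
  have hadd (m : ℕ) (v w : Fin 2 → K) : T^[m] (v + w) = T^[m] v + T^[m] w := by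
    induction m generalizing v w with
    | zero => rfl
    | succ m ih => simp only [Function.iterate_succ_apply, map_add, ih]
  obtain ⟨τ, hτ⟩ := exists_smul_eq_of_bracket_eq_zero (AddMonoidHom.mk' T^[h] (hadd h))
    (fun a v => (iterate_semilinear T hT h a v).trans (by rw [hpow]; rfl)) hTh
  replace hτ : ∀ v, T^[h] v = τ • v := hτ
  have hone : (fun _ => 1 : Fin 2 → K) ≠ 0 := fun h => by simpa using congrFun h 0
  have hTone : T (fun _ => 1) ≠ 0 := fun h => hone (hT0 _ h)
  -- T commutes with its h-th iterate, the scalar τ, while T is q-semilinear.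
  have hτq : τ ^ Fintype.card F = τ := by
    have h1 : T (T^[h] fun _ => 1) = T^[h] (T fun _ => 1) := by
      rw [← Function.iterate_succ_apply T, ← Function.iterate_succ_apply' T]
    rw [hτ, hτ, hT] at h1
    exact smul_left_injective K hTone h1
  have hτ0 : τ ≠ 0 := by
    rintro rfl
    have hinj : ∀ m v, T^[m] v = 0 → v = 0 := by
      intro m
      induction m with
      | zero => exact fun v hv => hv
      | succ m ih => exact fun v hv => hT0 v (ih _ hv)
    exact hone (hinj h _ (by rw [hτ, zero_smul]))
  obtain ⟨y, hy⟩ := exists_algebraMap_eq_of_pow_card_eq F hτq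
  -- Replacing T by μT multiplies its h-th iterate by the norm of μ, so norm τ⁻¹ makes that iterate
  -- the identity.
  obtain ⟨μ, hμ⟩ := FiniteField.norm_surjective F K y⁻¹
  have hμτ : (∏ i ∈ Finset.range h, μ ^ Fintype.card F ^ i) * τ = 1 := by
    have h1 := FiniteField.algebraMap_norm_eq_prod_pow F K μ
    rw [hμ, hfin, Nat.card_eq_fintype_card, map_inv₀, hy] at h1
    rw [← h1, inv_mul_cancel₀ hτ0]
  have hμ0 : μ ≠ 0 := by
    rintro rfl
    rw [Finset.prod_eq_zero (Finset.mem_range.mpr hh) (by simp), zero_mul] at hμτ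
    exact zero_ne_one hμτ
  let T' : (Fin 2 → K) →+ (Fin 2 → K) :=
    AddMonoidHom.mk' (fun v => μ • T v) fun v w => by rw [map_add, smul_add]
  have hT' (v : Fin 2 → K) : T' v = μ • T v := rfl
  have hT's (a : K) (v : Fin 2 → K) : T' (a • v) = a ^ Fintype.card F • T' v := by
    rw [hT', hT', hT, smul_comm]
  have hiter (m : ℕ) (v : Fin 2 → K) :
      T'^[m] v = (∏ i ∈ Finset.range m, μ ^ Fintype.card F ^ i) • T^[m] v := by
    induction m with
    | zero => simp
    | succ m ih =>
      rw [Function.iterate_succ_apply', ih, hT', hT, Finset.prod_range_succ', smul_smul,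
        Function.iterate_succ_apply', ← Finset.prod_pow]
      simp only [pow_zero, pow_one, ← pow_mul, ← pow_succ]
      rw [mul_comm]
  have hT'h (v : Fin 2 → K) : T'^[h] v = v := by
    rw [hiter, hτ, smul_smul, hμτ, one_smul]
  have hfix (w : Fin 2 → K) (hw : T' w = w) : T w = μ⁻¹ • w := by
    rw [eq_inv_smul_iff₀ hμ0, ← hT', hw]
  obtain ⟨w₁, hw₁, hne₁⟩ := exists_fixed_bracket_ne_zero hq hh hK T' hT's hT'h hone
  -- The second fixed vector is chosen off the line of the first.
  obtain ⟨w₂, hw₂, hne₂⟩ := exists_fixed_bracket_ne_zero hq hh hK T' hT's hT'h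
    (ne_zero_of_bracket_ne_zero hne₁)
  exact ⟨μ⁻¹, w₂, w₁, hne₂, hfix _ hw₂, hfix _ hw₁⟩

end Semilinear

/-! ### Descent of curves from K to F. -/

section Descent

variable (F : Type*) {K : Type*} [Field F] [Field K] [Algebra F K] {n d : ℕ}

theorem inclusion_ne_zero {k : ℕ} {v : Fin k → F} (hv : v ≠ 0) :
    (fun i => algebraMap F K (v i)) ≠ 0 := fun h =>
  hv (funext fun i => (algebraMap F K).injective (by simpa using congrFun h i))

theorem subgeometryEmbedding_curve_point (g : Module.Basis (Fin n) K (Form K (n - 1)))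
    (m : Module.Basis (Fin n) F (Form F (n - 1)))
    (hm : ∀ j, mapForm (algebraMap F K) (m j) = g j) (v : Fin 2 → F) (hv : v ≠ 0)
    (hv' : (fun i => algebraMap F K (v i)) ≠ 0) :
    subgeometryEmbedding F K n (Projectivization.mk F _ (eval_basis_ne_zero m v hv)) =
      Projectivization.mk K _ (eval_basis_ne_zero g _ hv') := by
  rw [subgeometryEmbedding, Projectivization.map_mk]
  congr 1
  funext j
  change algebraMap F K (ev v (m j)) = ev (fun i => algebraMap F K (v i)) (g j)
  rw [← ev_mapForm, hm]

variable [Fintype F]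

/-- A binary form fixed by the Frobenius map is defined over `F`. -/
theorem exists_mapForm_eq {p : Form K d}
    (hp : mapForm (FiniteField.frobeniusAlgHom F K : K →+* K) p = p) :
    ∃ r : Form F d, mapForm (algebraMap F K) r = p := by
  have hcoeff (e : Fin 2 →₀ ℕ) : ∃ y : F,
      algebraMap F K y = MvPolynomial.coeff e (p : MvPolynomial (Fin 2) K) := by
    refine exists_algebraMap_eq_of_pow_card_eq F ?_
    conv_rhs => rw [← hp]
    simp only [mapForm, MvPolynomial.coeff_map]
    rfl
  choose y hy using hcoeff
  let r : MvPolynomial (Fin 2) F :=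
    ∑ e ∈ (p : MvPolynomial (Fin 2) K).support, MvPolynomial.monomial e (y e)
  have hr : MvPolynomial.map (algebraMap F K) r = p := by
    simp only [r, map_sum, MvPolynomial.map_monomial, hy]
    exact (MvPolynomial.as_sum _).symm
  refine ⟨⟨r, (MvPolynomial.mem_homogeneousSubmodule _ _).mpr ?_⟩, Subtype.ext hr⟩
  refine MvPolynomial.IsHomogeneous.of_map (algebraMap F K).injective ?_
  rw [hr]
  exact (MvPolynomial.mem_homogeneousSubmodule _ _).mp p.2

theorem mapForm_frobenius_mapForm (r : Form F d) :
    mapForm (FiniteField.frobeniusAlgHom F K : K →+* K) (mapForm (algebraMap F K) r) =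
      mapForm (algebraMap F K) r := by
  apply Subtype.ext
  simp only [mapForm, MvPolynomial.map_map]
  congr 2
  ext x
  exact (FiniteField.frobeniusAlgHom F K).commutes x

/-- A basis of binary forms fixed by the Frobenius map comes from a basis over `F`. -/
theorem exists_basis_mapForm_eq (g : Module.Basis (Fin n) K (Form K d))
    (hg : ∀ j, mapForm (FiniteField.frobeniusAlgHom F K : K →+* K) (g j) = g j) :
    ∃ m : Module.Basis (Fin n) F (Form F d), ∀ j, mapForm (algebraMap F K) (m j) = g j := by
  choose m hm using fun j => exists_mapForm_eq F (hg j)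
  have hlin : LinearIndependent F m := by
    rw [Fintype.linearIndependent_iff]
    intro a ha j
    have h0 : ∑ i, algebraMap F K (a i) • g i = 0 := by
      simp only [← hm]
      rw [← mapForm_sum_smul, ha]
      apply Subtype.ext
      simp [mapForm]
    exact (map_eq_zero _).mp (Fintype.linearIndependent_iff.mp g.linearIndependent _ h0 j)
  have hspan : ⊤ ≤ Submodule.span F (Set.range m) := by
    rintro r -
    set p := mapForm (algebraMap F K) r with hp
    -- Frobenius fixes both p and the basis, hence also the coordinates of p.
    have hfix (j : Fin n) : ∃ y : F, algebraMap F K y = g.repr p j := by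
      refine exists_algebraMap_eq_of_pow_card_eq F ?_
      have h1 := mapForm_frobenius_mapForm (K := K) F r
      rw [← hp, ← g.sum_repr p, mapForm_sum_smul] at h1
      simp only [hg] at h1
      have h2 := congrArg (fun x => g.repr x j) h1
      simpa [Finsupp.single_apply] using h2
    choose y hy using hfix
    have hr : r = ∑ j, y j • m j := by
      apply mapForm_injective (algebraMap F K)
      rw [mapForm_sum_smul]
      simp only [hy, hm, g.sum_repr]
      rfl
    rw [hr]
    exact Submodule.sum_mem _ fun i _ =>
      Submodule.smul_mem _ _ (Submodule.subset_span (Set.mem_range_self i))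
  exact ⟨Module.Basis.mk hlin hspan, fun j => by rw [Module.Basis.mk_apply, hm]⟩

/-- The points of the canonical subgeometry on a normal rational curve defined over `F`. -/
theorem curve_inter_subgeometry (hn : 2 ≤ n) (g : Module.Basis (Fin n) K (Form K (n - 1)))
    (m : Module.Basis (Fin n) F (Form F (n - 1)))
    (hm : ∀ j, mapForm (algebraMap F K) (m j) = g j) :
    curve g ∩ subgeometry F K n = subgeometryEmbedding F K n '' curve m := by
  apply Set.Subset.antisymm
  · rintro _ ⟨⟨v, hv, rfl⟩, ⟨Q, hQ⟩⟩
    induction Q using Projectivization.ind with | h x hx => ?_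
    rw [subgeometryEmbedding, Projectivization.map_mk] at hQ
    obtain ⟨a, ha⟩ := (Projectivization.mk_eq_mk_iff' K _ _ _ _).mp hQ.symm
    have ha' (j : Fin n) : ev v (g j) = a * algebraMap F K (x j) := (congrFun ha j).symm
    have ha0 : a ≠ 0 := by
      rintro rfl
      obtain ⟨j, hj⟩ := exists_ev_ne_zero g hv
      exact hj (by rw [ha', zero_mul])
    set φ : K →+* K := (FiniteField.frobeniusAlgHom F K : K →+* K) with hφ
    have hφF (y : F) : φ (algebraMap F K y) = algebraMap F K y :=
      (FiniteField.frobeniusAlgHom F K).commutes y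
    -- The point lies in Σ and the forms have coefficients in F, so v and its conjugate parametrize
    -- the same point; hence the ratio of the coordinates of v lies in F.
    have hbr : bracket (fun i => φ (v i)) v = 0 := by
      refine bracket_eq_zero_of_ev (by omega) g (c := φ a / a) fun j => ?_
      have h1 : ev (fun i => φ (v i)) (g j) = φ (ev v (g j)) := by
        rw [← ev_mapForm, ← hm, mapForm_frobenius_mapForm]
      rw [h1, ha', map_mul, hφF]
      field_simp
    obtain ⟨w, hw, b, hb⟩ : ∃ w : Fin 2 → F, w ≠ 0 ∧
        ∃ b : K, v = b • fun i => algebraMap F K (w i) := by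
      have hbr' : v 0 ^ Fintype.card F * v 1 = v 1 ^ Fintype.card F * v 0 := sub_eq_zero.mp hbr
      by_cases h1 : v 1 = 0
      · refine ⟨![1, 0], fun h => by simpa using congrFun h 0, v 0, ?_⟩
        ext i; fin_cases i <;> simp [h1]
      · obtain ⟨y, hy⟩ := exists_algebraMap_eq_of_pow_card_eq F (x := v 0 / v 1) (by
          rw [div_pow, div_eq_div_iff (pow_ne_zero _ h1) h1, hbr', mul_comm])
        refine ⟨![y, 1], fun h => by simpa using congrFun h 1, v 1, ?_⟩
        ext i; fin_cases i
        · simp [hy, mul_div_cancel₀ _ h1]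
        · simp
    refine ⟨_, ⟨w, hw, rfl⟩, ?_⟩
    rw [subgeometryEmbedding_curve_point F g m hm w hw (inclusion_ne_zero F hw)]
    symm
    refine (Projectivization.mk_eq_mk_iff' K _ _ _ _).mpr ⟨b ^ (n - 1), ?_⟩
    funext j
    change b ^ (n - 1) * ev _ (g j) = ev v (g j)
    rw [hb, ev_smul]
  · rintro _ ⟨_, ⟨v, hv, rfl⟩, rfl⟩
    refine ⟨?_, Set.mem_range_self _⟩
    rw [subgeometryEmbedding_curve_point F g m hm v hv (inclusion_ne_zero F hv)]
    exact ⟨_, inclusion_ne_zero F hv, rfl⟩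

variable [Fintype K]

/-- A normal rational curve meeting the canonical subgeometry in a normal rational curve is
invariant under the Frobenius collineation. -/
theorem image_frobeniusCollineation_eq_of_inter (hn : 2 ≤ n) (hq : n + 1 ≤ Fintype.card F)
    (g : Module.Basis (Fin n) K (Form K (n - 1))) (m : Module.Basis (Fin n) F (Form F (n - 1)))
    (h : subgeometryEmbedding F K n '' curve m ⊆ curve g) :
    frobeniusCollineation F K n '' curve g = curve g := by
  set g' := mapBasis (algebraMap F K) (finrank_form g) m with hg'
  have hm (j : Fin n) : mapForm (algebraMap F K) (m j) = g' j := by rw [hg', mapBasis_apply]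
  have hmem (v : Fin 2 → F) (hv : v ≠ 0) : ∃ t : Fin 2 → K, ∃ a : K,
      ∀ j, ev (fun i => algebraMap F K (v i)) (g' j) = a * ev t (g j) := by
    have h1 := h (Set.mem_image_of_mem _ ⟨v, hv, rfl⟩)
    rw [subgeometryEmbedding_curve_point F g' m hm v hv (inclusion_ne_zero F hv),
      mem_curve_iff] at h1
    obtain ⟨t, -, a, ha⟩ := h1
    exact ⟨t, a, ha⟩
  have hpt0 (o : Option F) : linePoints F o ≠ 0 := by
    obtain ⟨o', ho'⟩ := exists_ne o
    exact ne_zero_of_bracket_ne_zero (pairwiseIndep_linePoints F ho'.symm)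
  -- The extended curve and the given one share the q + 1 ≥ n + 2 points with F-rational parameter.
  obtain ⟨B, κ, hB, hκ, hBκ⟩ := exists_matrix_of_mem_curve hn (by rw [Fintype.card_option]; omega)
    g g' ((pairwiseIndep_linePoints F).map (algebraMap F K)) fun o => hmem _ (hpt0 o)
  rw [← curve_eq_of_matrix g g' hB hκ hBκ]
  exact image_frobeniusCollineation_curve_eq F g' fun j => by
    rw [← hm, mapForm_frobenius_mapForm]

/-- A normal rational curve invariant under the Frobenius collineation has a parametrization fixed
by the Frobenius map. -/
theorem exists_frobenius_fixed_basis (hn : 2 ≤ n) (hq : n + 1 ≤ Fintype.card F) {h : ℕ}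
    (hh : 0 < h) (hK : Fintype.card K = Fintype.card F ^ h)
    (g : Module.Basis (Fin n) K (Form K (n - 1)))
    (hg : frobeniusCollineation F K n '' curve g = curve g) :
    ∃ g' : Module.Basis (Fin n) K (Form K (n - 1)), curve g' = curve g ∧
      ∀ j, mapForm (FiniteField.frobeniusAlgHom F K : K →+* K) (g' j) = g' j := by
  set φ : K →+* K := (FiniteField.frobeniusAlgHom F K : K →+* K) with hφ
  have hφq (x : K) : φ x = x ^ Fintype.card F := rfl
  set gφ := mapBasis φ (finrank_form g) g with hgφ
  have hline : PairwiseIndep (fun o i => algebraMap F K (linePoints F o i)) :=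
    (pairwiseIndep_linePoints F).map (algebraMap F K)
  have hpt0 (o : Option F) : (fun i => algebraMap F K (linePoints F o i)) ≠ 0 := by
    obtain ⟨o', ho'⟩ := exists_ne o
    exact ne_zero_of_bracket_ne_zero (hline ho'.symm)
  have hcard : n + 2 ≤ Fintype.card (Option F) := by rw [Fintype.card_option]; omega
  rw [image_frobeniusCollineation_curve] at hg
  obtain ⟨B, κ, hB, hκ, hBκ⟩ := exists_matrix_of_mem_curve hn hcard g gφ hline fun o => by
    have h1 : Projectivization.mk K _ (eval_basis_ne_zero gφ _ (hpt0 o)) ∈ curve gφ :=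
      ⟨_, hpt0 o, rfl⟩
    rw [hg, mem_curve_iff] at h1
    obtain ⟨t, -, a, ha⟩ := h1
    exact ⟨t, a, ha⟩
  let T : (Fin 2 → K) →+ (Fin 2 → K) :=
    AddMonoidHom.mk' (fun v => B.mulVec fun i => φ (v i)) fun v w => by
      rw [← Matrix.mulVec_add]
      congr 1
      funext i
      simp
  have hTv (v : Fin 2 → K) : T v = B.mulVec fun i => φ (v i) := rfl
  have hT (a : K) (v : Fin 2 → K) : T (a • v) = a ^ Fintype.card F • T v := by
    rw [hTv, hTv, ← hφq, ← Matrix.mulVec_smul]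
    congr 1
    funext i
    simp
  have hT0 (v : Fin 2 → K) (hv : T v = 0) : v = 0 := by
    have := Matrix.eq_zero_of_mulVec_eq_zero hB ((hTv v).symm.trans hv)
    exact funext fun i => φ.injective (by simpa using congrFun this i)
  have hφg (v : Fin 2 → K) (j : Fin n) : φ (ev v (g j)) = κ * ev (T v) (g j) := by
    rw [← ev_mapForm, hTv, ← hBκ, hgφ, mapBasis_apply]
  -- T induces Ψ on parameters; at m = h the power map on K is the identity, and injectivity of the
  -- parametrization makes T^h fix each point.
  have hiter (m : ℕ) : ∃ c : K, ∀ v j, ev (T^[m] v) (g j) = c * ev v (g j) ^ Fintype.card F ^ m := by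
    induction m with
    | zero => exact ⟨1, fun v j => by simp⟩
    | succ m ih =>
      obtain ⟨c, hc⟩ := ih
      refine ⟨κ⁻¹ * φ c, fun v j => ?_⟩
      have h1 := hφg (T^[m] v) j
      rw [hc, map_mul, map_pow, hφq (ev v (g j)), ← pow_mul, ← pow_succ',
        ← Function.iterate_succ_apply' T] at h1
      rw [mul_assoc, h1, inv_mul_cancel_left₀ hκ]
  have hTh (v : Fin 2 → K) : bracket (T^[h] v) v = 0 := by
    obtain ⟨c, hc⟩ := hiter h
    refine bracket_eq_zero_of_ev (by omega) g (c := c) fun j => ?_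
    rw [hc, ← hK, FiniteField.pow_card]
  obtain ⟨ν, w₁, w₂, hw, hw₁, hw₂⟩ := exists_fixed_subline F hh hK T hT hT0 hTh
  let A : Matrix (Fin 2) (Fin 2) K := Matrix.of fun i j => ![w₁ i, w₂ i] j
  have hAv (v : Fin 2 → K) : A.mulVec v = v 0 • w₁ + v 1 • w₂ := by
    ext i
    simp [A, Matrix.mulVec, dotProduct, Fin.sum_univ_two, mul_comm]
  have hA : A.det ≠ 0 := by
    convert hw using 1
    simp only [A, Matrix.det_fin_two, Matrix.of_apply, Matrix.cons_val_zero, Matrix.cons_val_one,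
      bracket]
    ring
  have hTA (v : Fin 2 → K) : T (A.mulVec v) = ν • A.mulVec fun i => φ (v i) := by
    rw [hAv, hAv, map_add, hT, hT, hw₁, hw₂, hφq, hφq, smul_add, smul_comm ν, smul_comm ν]
  have hg1 (v : Fin 2 → K) (j : Fin n) : φ (ev (A.mulVec v) (g j)) =
      κ * ν ^ (n - 1) * ev (A.mulVec fun i => φ (v i)) (g j) := by
    rw [hφg, hTA, ev_smul, mul_assoc]
  have he : (![1, 0] : Fin 2 → K) ≠ 0 := fun h => by simpa using congrFun h 0
  have hφe : (fun i => φ ((![1, 0] : Fin 2 → K) i)) = ![1, 0] := by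
    ext i; fin_cases i <;> simp
  obtain ⟨j₀, hj₀⟩ := exists_ev_ne_zero g (mulVec_ne_zero hA he)
  -- Evaluating at a Frobenius-fixed parameter, δ picks up exactly the factor κν^(n-1) under φ;
  -- dividing the basis by δ cancels that factor.
  set δ := ev (A.mulVec ![1, 0]) (g j₀) with hδ
  have hδφ : φ δ = κ * ν ^ (n - 1) * δ := by
    have := hg1 ![1, 0] j₀
    rwa [hφe] at this
  let g' : Module.Basis (Fin n) K (Form K (n - 1)) :=
    (g.map (compMatrixEquiv A hA)).isUnitSMul (w := fun _ => δ⁻¹) fun _ => (inv_ne_zero hj₀).isUnit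
  have hg' (v : Fin 2 → K) (j : Fin n) : ev v (g' j) = δ⁻¹ * ev (A.mulVec v) (g j) := by
    have : g' j = δ⁻¹ • compMatrix A (g j) := by
      simp only [g', Module.Basis.isUnitSMul_apply, Module.Basis.map_apply]
      rfl
    rw [this, map_smul, smul_eq_mul, ev_compMatrix]
  refine ⟨g', curve_eq_of_matrix g g' hA (inv_ne_zero hj₀) hg', fun j => sub_eq_zero.mp ?_⟩
  obtain ⟨S, -, hS⟩ := Finset.exists_subset_card_eq (s := (Finset.univ : Finset (Option F)))
    (n := n - 1 + 1) (by rw [Finset.card_univ]; omega)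
  -- Two forms of degree n - 1 are compared at n of the F-rational points, which φ fixes.
  refine form_eq_zero (by rw [finrank_form g]; omega) hline hS fun o _ => ?_
  have key (v : Fin 2 → K) : ev (fun i => φ (v i)) (mapForm φ (g' j)) =
      ev (fun i => φ (v i)) (g' j) := by
    have hδ0 : φ δ ≠ 0 := (map_ne_zero φ).mpr hj₀
    rw [ev_mapForm, hg', hg', map_mul, map_inv₀, hg1 v j, inv_mul_eq_iff_eq_mul₀ hδ0, hδφ]
    field_simp
  have hfix : (fun i => φ (algebraMap F K (linePoints F o i))) =
      fun i => algebraMap F K (linePoints F o i) :=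
    funext fun i => (FiniteField.frobeniusAlgHom F K).commutes _
  have := key fun i => algebraMap F K (linePoints F o i)
  rw [hfix] at this
  rw [map_sub, this, sub_self]

end Descent

/-! ### The one-point case and the final equivalence. -/

theorem curve_nonempty {K : Type*} [Field K] {n : ℕ}
    (g : Module.Basis (Fin n) K (Form K (n - 1))) : (curve g).Nonempty :=
  ⟨_, ![1, 0], fun h => by simpa using congrFun h 0, rfl⟩

theorem subsingleton_projectivization_fin_one {K : Type*} [Field K] :
    Subsingleton (ℙ K (Fin 1 → K)) := by
  refine ⟨fun P Q => ?_⟩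
  induction P using Projectivization.ind with | h x hx => ?_
  induction Q using Projectivization.ind with | h y hy => ?_
  have hy0 : y 0 ≠ 0 := fun h => hy (funext fun i => by rw [Subsingleton.elim i 0, h]; rfl)
  refine (Projectivization.mk_eq_mk_iff' K _ _ _ _).mpr ⟨x 0 / y 0, funext fun i => ?_⟩
  rw [Subsingleton.elim i 0, Pi.smul_apply, smul_eq_mul, div_mul_cancel₀ _ hy0]

/-- On the one-point space `PG(0, K)` with `K` of the same size as `F`, the normal rational curves
over `K` and `F` correspond. -/
theorem exists_inter_subgeometry_of_card_eq (F : Type*) {K : Type*} [Field F] [Field K]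
    [Algebra F K] [Fintype F] [Fintype K] (hK : Fintype.card K = Fintype.card F)
    (g : Module.Basis (Fin 1) K (Form K (1 - 1))) :
    ∃ M : Set (ℙ F (Fin 1 → F)), IsNormalRationalCurve M ∧
      curve g ∩ subgeometry F K 1 = subgeometryEmbedding F K 1 '' M := by
  have := subsingleton_projectivization_fin_one (K := K)
  -- As |K| = |F|, Frobenius is the identity and every basis descends.
  obtain ⟨m, -⟩ := exists_basis_mapForm_eq F g fun j => by
    apply Subtype.ext
    have : (FiniteField.frobeniusAlgHom F K : K →+* K) = RingHom.id K := by
      ext x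
      change x ^ Fintype.card F = x
      rw [← hK, FiniteField.pow_card]
    simp only [mapForm, this, MvPolynomial.map_id]
  obtain ⟨P, hP⟩ := curve_nonempty g
  obtain ⟨Q, hQ⟩ := curve_nonempty m
  refine ⟨curve m, ⟨m, rfl⟩, ?_⟩
  rw [Set.Nonempty.eq_univ (s := subgeometryEmbedding F K 1 '' curve m) ⟨_, Q, hQ, rfl⟩]
  exact Set.Nonempty.eq_univ
    ⟨P, hP, ⟨Q, Subsingleton.elim _ _⟩⟩

theorem exists_inter_subgeometry_iff (F : Type*) {K : Type*} [Field F] [Field K]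
    [Algebra F K] [Fintype F] [Fintype K] {n h : ℕ} (hh : 0 < h) (hn : 0 < n) (hhn : h ≤ n)
    (hq : n + 1 ≤ Fintype.card F) (hK : Fintype.card K = Fintype.card F ^ h)
    (g : Module.Basis (Fin n) K (Form K (n - 1))) :
    (∃ M : Set (ℙ F (Fin n → F)), IsNormalRationalCurve M ∧
      curve g ∩ subgeometry F K n = subgeometryEmbedding F K n '' M) ↔
    frobeniusCollineation F K n '' curve g = curve g := by
  -- For n = 1 the forms are constants and the parametrization is not injective, so this case is
  -- separate; there h ≤ n forces h = 1.
  rcases (show n = 1 ∨ 2 ≤ n by omega) with rfl | hn2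
  · obtain rfl : h = 1 := by omega
    have := subsingleton_projectivization_fin_one (K := K)
    rw [pow_one] at hK
    refine iff_of_true (exists_inter_subgeometry_of_card_eq F hK g) ?_
    rw [((curve_nonempty g).image _).eq_univ, (curve_nonempty g).eq_univ]
  · constructor
    · rintro ⟨_, ⟨m, rfl⟩, hM⟩
      exact image_frobeniusCollineation_eq_of_inter F hn2 hq g m (hM ▸ Set.inter_subset_left)
    · intro hg
      obtain ⟨g', hg', hfix⟩ := exists_frobenius_fixed_basis F hn2 hq hh hK g hg
      obtain ⟨m, hm⟩ := exists_basis_mapForm_eq F g' hfix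
      exact ⟨curve m, ⟨m, rfl⟩, hg' ▸ curve_inter_subgeometry F hn2 g' m hm⟩

end NRC

theorem mainTheorem8 (q h k : ℕ) (hh : 0 < h) (hk : 0 < k) (hq : h * k + 1 ≤ q)
    (F K : Type*) [Field F] [Fintype F] [Field K] [Fintype K] [Algebra F K]
    (hF : Fintype.card F = q) (hK : Fintype.card K = q ^ h)
    (N : Set (ℙ K (Fin (h * k) → K))) (hN : NRC.IsNormalRationalCurve N) :
    (∃ M : Set (ℙ F (Fin (h * k) → F)), NRC.IsNormalRationalCurve M ∧
      N ∩ NRC.subgeometry F K (h * k) = NRC.subgeometryEmbedding F K (h * k) '' M) ↔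
    NRC.frobeniusCollineation F K (h * k) '' N = N := by
  subst hF
  obtain ⟨g, rfl⟩ := hN
  exact NRC.exists_inter_subgeometry_iff F hh (Nat.mul_pos hh hk)
    (Nat.le_mul_of_pos_right h hk) hq hK g
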